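/- Let $N\ge 1$ be an integer and put $$k_1=\frac{N\pi}{2},\qquad k_2=4N\Big(1-\frac{\pi^2}{16}\Big),\qquad a=\frac{k_1^2}{k_2}-1,\qquad b=\frac{k_2}{k_1}.$$ The end-to-end gain of a reconfigurable intelligent surface with $N$ units is $A=\sum_{i=1}^N|h_i||g_i|$, and the closed-form (Gamma-type) density used for it is $$f_A(x)=\frac{x^a e^{-x/b}}{b^{a+1}\Gamma(a+1)},\quad x>0 .$$ The ergodic capacity at transmit signal-to-noise ratio $\rho>0$ is $C(\rho)=\int_0^\infty\log_2(1+\rho y^2)f_A(y)\,dy$. Let $F_0$ be the digamma function, $(x)_n$ the Pochhammer symbol and ${}_pF_q$ the generalized hypergeometric function. For a constant $c$ let $$\begin{aligned}T_c(\rho)={}&\frac{a^2-a}{(a-1)_2}\log_2(b^2\rho)+\frac{2(a^2-a)}{\ln(2)(a-1)_2}F_0(c+a)+\frac{\pi\csc(\frac{a\pi}{2})\;{}_1F_2(1+\frac a2;\frac32,2+\frac a2;-\frac1{4b^2\rho})}{\ln(2)(2+a)b^{a+2}\Gamma(a+1)\rho^{a/2+1}}\\&+\frac{\pi\sec(\frac{a\pi}{2})\;{}_1F_2(\frac{a+1}2;\frac12,\frac{a+3}2;-\frac1{4b^2\rho})}{(a+1)b^{a+1}\ln(2)\Gamma(a+1)\rho^{(a+1)/2}}+\frac{{}_2F_3(1,1;2,1-\frac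 a2,\frac{3-a}2;-\frac1{4b^2\rho})}{\ln(2)(a-1)_2b^2\rho},\end{aligned}$$ and let $C_{c}(\rho)$ be the same expression with each of the three hypergeometric factors replaced by $1$: $$C_c(\rho)=\frac{a^2-a}{(a-1)_2}\log_2(b^2\rho)+\frac{2(a^2-a)}{\ln(2)(a-1)_2}F_0(c+a)+\frac{\pi\csc(\frac{a\pi}{2})}{\ln(2)(2+a)b^{a+2}\Gamma(a+1)\rho^{a/2+1}}+\frac{\pi\sec(\frac{a\pi}{2})}{(a+1)b^{a+1}\ln(2)\Gamma(a+1)\rho^{(a+1)/2}}+\frac{1}{\ln(2)(a-1)_2b^2\rho}.$$ Put $s(\rho)=\rho^{-1}+\rho^{-(a+1)/2}+\rho^{-(a/2+1)}$. Then, as $\rho\to\infty$: 1. The three hypergeometric series converge at every real argument, and the three hypergeometric factors in $T_c(\rho)$ tend to $1$. 2. The integral defining $C(\rho)$ converges for every $\rho>0$, and $C(\rho)-C_{1}(\rho)=o(s(\rho))$. 3. For $c\in\{1,3\}$: $T_c(\rho)-C_c(\rho)=o(s(\rho))$ and $C(\rho)/C_c(\rho)\to1$. 4. For $c\in\{1,3\}$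 and the exact channel model, in which the $2N$ complex channel coefficients $h_i,g_i$ are independent and the envelopes $|h_i|,|g_i|$ are Rayleigh distributed with scale parameter $1$: $\mathbb E[\log_2(1+\rho A^2)]$ is finite for every $\rho>0$, and $\mathbb E[\log_2(1+\rho A^2)]/C_c(\rho)\to1$. -/

import Mathlib

open Real Filter Topology MeasureTheory ProbabilityTheory Asymptotics Set

noncomputable section

/-- The Pochhammer symbol `(x)_n = x (x+1) ⋯ (x+n-1)`. -/
def poch (x : ℝ) (n : ℕ) : ℝ := (ascPochhammer ℝ n).eval x

/-- The `n`-th term of the generalized hypergeometric series `pFq(as; bs; x)`. -/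
def hypergeometricTerm (as bs : List ℝ) (x : ℝ) (n : ℕ) : ℝ :=
  (as.map fun α => poch α n).prod / (bs.map fun β => poch β n).prod * (x ^ n / (n.factorial : ℝ))

/-- The (non-regularized) generalized hypergeometric function `pFq(as; bs; x)`, for real
parameters and a real argument. -/
def hypergeometricPFQ (as bs : List ℝ) (x : ℝ) : ℝ := ∑' n, hypergeometricTerm as bs x n

/-- The digamma function (polygamma function of order zero) at a real argument. -/
def digammaReal (x : ℝ) : ℝ := (Complex.digamma (x : ℂ)).re

namespace RIS

/-- `k₁ = N π / 2`. -/
def k₁ (N : ℕ) : ℝ := N * π / 2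

/-- `k₂ = 4 N (1 - π² / 16)`. -/
def k₂ (N : ℕ) : ℝ := 4 * N * (1 - π ^ 2 / 16)

/-- `a = k₁² / k₂ - 1`. -/
def a (N : ℕ) : ℝ := k₁ N ^ 2 / k₂ N - 1

/-- `b = k₂ / k₁`. -/
def b (N : ℕ) : ℝ := k₂ N / k₁ N

/-- The closed-form density `f_A` (on `(0, ∞)`) of the end-to-end channel gain `A`. -/
def pdfA (N : ℕ) (x : ℝ) : ℝ :=
  x ^ a N / (b N ^ (a N + 1) * Gamma (a N + 1)) * exp (-x / b N)

/-- The ergodic capacity `∫₀^∞ log₂(1 + ρ y²) f_A(y) dy` at transmit SNR `ρ`. -/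
def ergodicCapacity (N : ℕ) (ρ : ℝ) : ℝ :=
  ∫ y in Ioi (0 : ℝ), logb 2 (1 + ρ * y ^ 2) * pdfA N y

/-- The Rayleigh distribution with scale parameter `σ`. -/
def rayleighMeasure (σ : ℝ) : Measure ℝ :=
  volume.withDensity fun x =>
    ENNReal.ofReal (if 0 ≤ x then x / σ ^ 2 * exp (-x ^ 2 / (2 * σ ^ 2)) else 0)

/-- The end-to-end gain `A = ∑ᵢ |hᵢ| |gᵢ|` under optimal phase shifts and unit reflected gains. -/
def gain {Ω : Type*} {N : ℕ} (h g : Fin N → Ω → ℂ) (ω : Ω) : ℝ :=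
  ∑ i, ‖h i ω‖ * ‖g i ω‖

/-- The factor `₁F₂(1 + a/2; 3/2, 2 + a/2; -1/(4 b² ρ))`. -/
def factorCsc (N : ℕ) (ρ : ℝ) : ℝ :=
  hypergeometricPFQ [1 + a N / 2] [3 / 2, 2 + a N / 2] (-(1 / (4 * b N ^ 2 * ρ)))

/-- The factor `₁F₂((a+1)/2; 1/2, (a+3)/2; -1/(4 b² ρ))`. -/
def factorSec (N : ℕ) (ρ : ℝ) : ℝ :=
  hypergeometricPFQ [(a N + 1) / 2] [1 / 2, (a N + 3) / 2] (-(1 / (4 * b N ^ 2 * ρ)))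

/-- The factor `₂F₃(1, 1; 2, 1 - a/2, (3-a)/2; -1/(4 b² ρ))`. -/
def factorInv (N : ℕ) (ρ : ℝ) : ℝ :=
  hypergeometricPFQ [1, 1] [2, 1 - a N / 2, (3 - a N) / 2] (-(1 / (4 * b N ^ 2 * ρ)))

/-- The capacity expression with digamma value `F₀(c + a)`, in which the three hypergeometric
factors have been given the values `u`, `v`, `w`. -/
def capacityExpr (c : ℝ) (N : ℕ) (ρ u v w : ℝ) : ℝ :=
  (a N ^ 2 - a N) / poch (a N - 1) 2 * logb 2 (b N ^ 2 * ρ)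
    + 2 * (a N ^ 2 - a N) / (log 2 * poch (a N - 1) 2) * digammaReal (c + a N)
    + π * (sin (a N * π / 2))⁻¹ * u
        / (log 2 * (2 + a N) * b N ^ (a N + 2) * Gamma (a N + 1) * ρ ^ (a N / 2 + 1))
    + π * (cos (a N * π / 2))⁻¹ * v
        / ((a N + 1) * b N ^ (a N + 1) * log 2 * Gamma (a N + 1) * ρ ^ ((a N + 1) / 2))
    + w / (log 2 * poch (a N - 1) 2 * b N ^ 2 * ρ)

/-- The closed-form expression for the capacity, with its hypergeometric factors. -/
def capacityClosedForm (c : ℝ) (N : ℕ) (ρ : ℝ) : ℝ :=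
  capacityExpr c N ρ (factorCsc N ρ) (factorSec N ρ) (factorInv N ρ)

/-- The high-SNR expression: every hypergeometric factor is replaced by `1`. -/
def capacityHighSNR (c : ℝ) (N : ℕ) (ρ : ℝ) : ℝ :=
  capacityExpr c N ρ 1 1 1

/-- Sum of the powers of `ρ` that occur in the decaying terms of the high-SNR expression. -/
def decayScale (N : ℕ) (ρ : ℝ) : ℝ :=
  ρ⁻¹ + ρ ^ (-((a N + 1) / 2)) + ρ ^ (-(a N / 2 + 1))

end RIS

end

/-! Everything rests on `log (1 + ρ y²) = log ρ + 2 log y + log (1 + (ρ y²)⁻¹)`. Against the Gamma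
density the first two summands integrate exactly, to the logarithmic term and the digamma term with
`c = 1`. Only the third depends delicately on `ρ`, and its leading order is decided near `y = 0`.

If `a > 1`, then `y ^ (a - 2)` is integrable at `0` and dominated convergence gives the `ρ⁻¹` term
(`tendsto_mul_integral_log_one_add_inv`). If `a < 1`, the mass sits at `y ~ ρ ^ (-1/2)`; rescaling
gives the secant term (`tendsto_rpow_mul_integral_log_one_add_inv`), whose constant comes from
Euler's reflection formula. Bounds on `π` show `a < 1` for `N = 1` and `a > 1` for `N ≥ 2`. The
remaining powers are of lower order in each case.

The ratio statements are coarser: every quantity is asymptotic to `logb 2 ρ`, so the value of `c`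
does not matter. For the Rayleigh model this follows by dominated convergence from a finite mean and
almost sure positivity of the gain. -/

noncomputable section

/-! ### Hypergeometric series: convergence and the limit at zero -/

theorem poch_succ (x : ℝ) (n : ℕ) : poch x (n + 1) = poch x n * (x + n) := by
  simp [poch, ascPochhammer_succ_eval]

theorem hypergeometricTerm_zero (as bs : List ℝ) (x : ℝ) : hypergeometricTerm as bs x 0 = 1 := by
  simp [hypergeometricTerm, poch]

theorem prod_map_poch_succ (l : List ℝ) (n : ℕ) :
    (l.map fun α => poch α (n + 1)).prod
      = (l.map fun α => poch α n).prod * (l.map fun α => α + (n : ℝ)).prod := by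
  simp only [poch_succ, List.prod_map_mul]

/-- Valid even when a lower parameter is a nonpositive integer: with `x / 0 = 0` both sides then
vanish from that index on, so no genericity of `a` is needed. -/
theorem hypergeometricTerm_succ (as bs : List ℝ) (x : ℝ) (n : ℕ) :
    hypergeometricTerm as bs x (n + 1) = hypergeometricTerm as bs x n *
      ((as.map fun α => α + (n : ℝ)).prod / (bs.map fun β => β + (n : ℝ)).prod * (x / (n + 1))) := by
  simp only [hypergeometricTerm, prod_map_poch_succ, Nat.factorial_succ, pow_succ, div_eq_mul_inv,
    mul_inv, Nat.cast_mul, Nat.cast_succ]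
  ring

theorem tendsto_const_add_div_const_add (α β : ℝ) :
    Tendsto (fun n : ℕ => (α + n) / (β + n)) atTop (𝓝 1) := by
  have h (γ : ℝ) : Tendsto (fun n : ℕ => γ / n + 1) atTop (𝓝 1) := by
    simpa using (tendsto_const_div_atTop_nhds_zero_nat γ).add_const 1
  have := (h α).div (h β) one_ne_zero
  rw [div_one] at this
  refine this.congr' ?_
  filter_upwards [eventually_gt_atTop 0] with n hn
  have : (n : ℝ) ≠ 0 := by positivity
  simp only [Pi.div_apply]
  rw [← mul_div_mul_right _ _ this, add_mul, add_mul, div_mul_cancel₀ _ this,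
    div_mul_cancel₀ _ this, one_mul]

theorem tendsto_inv_const_add (β : ℝ) : Tendsto (fun n : ℕ => (β + n)⁻¹) atTop (𝓝 0) :=
  tendsto_inv_atTop_zero.comp (tendsto_atTop_add_const_left _ _ tendsto_natCast_atTop_atTop)

/-- The hypergeometric series converges everywhere as soon as the ratio of the products of the
shifted parameters stays bounded. -/
theorem summable_hypergeometricTerm {as bs : List ℝ} {l : ℝ}
    (h : Tendsto (fun n : ℕ =>
      (as.map fun α => α + (n : ℝ)).prod / (bs.map fun β => β + (n : ℝ)).prod) atTop (𝓝 l))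
    (x : ℝ) : Summable (hypergeometricTerm as bs x) := by
  have h1 : Tendsto (fun n : ℕ => x / ((n : ℝ) + 1)) atTop (𝓝 0) := by
    simpa [div_eq_mul_inv, add_comm] using (tendsto_inv_const_add 1).const_mul x
  have h2 := (h.mul h1).norm
  simp only [mul_zero, norm_zero] at h2
  refine summable_of_ratio_norm_eventually_le (r := 1 / 2) (by norm_num) ?_
  filter_upwards [h2.eventually_le_const (show (0 : ℝ) < 1 / 2 by norm_num)] with n hn
  rw [hypergeometricTerm_succ, norm_mul, mul_comm]
  gcongr

theorem norm_hypergeometricTerm_le {as bs : List ℝ} {x : ℝ} (hx : |x| ≤ 1) (n : ℕ) :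
    ‖hypergeometricTerm as bs x n‖ ≤ ‖hypergeometricTerm as bs 1 n‖ := by
  simp only [hypergeometricTerm, norm_mul, norm_div, norm_pow, one_pow]
  gcongr
  simpa using pow_le_one₀ (abs_nonneg x) hx

/-- On `|x| ≤ 1` the terms are dominated by those at `x = 1`, so the limit passes inside the sum,
where only `n = 0` survives. -/
theorem tendsto_hypergeometricPFQ {as bs : List ℝ}
    (h : Summable (hypergeometricTerm as bs 1)) :
    Tendsto (hypergeometricPFQ as bs) (𝓝 0) (𝓝 1) := by
  have key : Tendsto (hypergeometricPFQ as bs) (𝓝 0)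
      (𝓝 (∑' n, hypergeometricTerm as bs 0 n)) := by
    refine tendsto_tsum_of_dominated_convergence h.norm (fun n => ?_) ?_
    · refine Continuous.tendsto ?_ 0
      unfold hypergeometricTerm
      fun_prop
    · filter_upwards [Metric.closedBall_mem_nhds (0 : ℝ) one_pos] with x hx n
      exact norm_hypergeometricTerm_le (by simpa using hx) n
  rwa [tsum_eq_single 0 fun n hn => by simp [hypergeometricTerm, hn],
    hypergeometricTerm_zero] at key

theorem summable_hypergeometricTerm_one_two (α β γ x : ℝ) :
    Summable (hypergeometricTerm [α] [β, γ] x) := by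
  -- Each upper parameter is paired with a lower one, giving a ratio tending to `1`; the unpaired
  -- lower parameter contributes the factor `0`.
  refine summable_hypergeometricTerm (l := 1 * 0) ?_ x
  refine ((tendsto_const_add_div_const_add α β).mul (tendsto_inv_const_add γ)).congr fun n => ?_
  simp [div_eq_mul_inv, mul_assoc, mul_comm]

theorem summable_hypergeometricTerm_two_three (α α' β γ δ x : ℝ) :
    Summable (hypergeometricTerm [α, α'] [β, γ, δ] x) := by
  refine summable_hypergeometricTerm (l := 1 * 1 * 0) ?_ x
  refine (((tendsto_const_add_div_const_add α β).mul
    (tendsto_const_add_div_const_add α' γ)).mul (tendsto_inv_const_add δ)).congr fun n => ?_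
  simp only [div_eq_mul_inv, List.map_cons, List.map_nil, List.prod_cons, List.prod_nil, mul_inv,
    mul_one]
  ring

/-! ### The hypergeometric factors and the size of `a` and `b` -/

namespace RIS

theorem tendsto_factor_arg (N : ℕ) :
    Tendsto (fun ρ : ℝ => -(1 / (4 * b N ^ 2 * ρ))) atTop (𝓝 0) := by
  have : Tendsto (fun ρ : ℝ => -((4 * b N ^ 2)⁻¹ * ρ⁻¹)) atTop (𝓝 (-((4 * b N ^ 2)⁻¹ * 0))) :=
    (tendsto_inv_atTop_zero.const_mul _).neg
  simpa [mul_comm] using this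

theorem tendsto_factorCsc (N : ℕ) : Tendsto (factorCsc N) atTop (𝓝 1) :=
  (tendsto_hypergeometricPFQ (summable_hypergeometricTerm_one_two _ _ _ _)).comp
    (tendsto_factor_arg N)

theorem tendsto_factorSec (N : ℕ) : Tendsto (factorSec N) atTop (𝓝 1) :=
  (tendsto_hypergeometricPFQ (summable_hypergeometricTerm_one_two _ _ _ _)).comp
    (tendsto_factor_arg N)

theorem tendsto_factorInv (N : ℕ) : Tendsto (factorInv N) atTop (𝓝 1) :=
  (tendsto_hypergeometricPFQ (summable_hypergeometricTerm_two_three _ _ _ _ _ _)).comp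
    (tendsto_factor_arg N)

theorem pi_sq_bounds : 9.85 < π ^ 2 ∧ π ^ 2 < 9.93 := by
  constructor <;> nlinarith [pi_gt_d2, pi_lt_d2]

theorem b_pos {N : ℕ} (hN : 1 ≤ N) : 0 < b N := by
  have hN' : (0 : ℝ) < N := by exact_mod_cast hN
  have := pi_sq_bounds.2
  have h1 : 0 < 1 - π ^ 2 / 16 := by linarith
  unfold b k₁ k₂
  positivity

theorem a_eq {N : ℕ} (hN : 1 ≤ N) : a N = N * (π ^ 2 / (16 - π ^ 2)) - 1 := by
  have hN' : (N : ℝ) ≠ 0 := by positivity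
  have h1 : 16 - π ^ 2 ≠ 0 := by linarith [pi_sq_bounds.2]
  have h2 : 1 - π ^ 2 / 16 ≠ 0 := by linarith [pi_sq_bounds.2]
  unfold a k₁ k₂
  field_simp
  ring

/-- Since `a = N r - 1` with this ratio `r`, what matters is `1 < r < 2`: it places `1` strictly
between `a 1` and `a 2`. -/
theorem ratio_bounds : 1.6 < π ^ 2 / (16 - π ^ 2) ∧ π ^ 2 / (16 - π ^ 2) < 1.7 := by
  have h := pi_sq_bounds
  have h1 : 0 < 16 - π ^ 2 := by linarith
  rw [lt_div_iff₀ h1, div_lt_iff₀ h1]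
  constructor <;> linarith

theorem a_pos {N : ℕ} (hN : 1 ≤ N) : 0 < a N := by
  have hN' : (1 : ℝ) ≤ N := by exact_mod_cast hN
  rw [a_eq hN]
  nlinarith [ratio_bounds.1]

theorem a_one_lt : a 1 < 1 := by
  rw [a_eq le_rfl]
  norm_num
  linarith [ratio_bounds.2]

theorem one_lt_a {N : ℕ} (hN : 2 ≤ N) : 1 < a N := by
  have hN' : (2 : ℝ) ≤ N := by exact_mod_cast hN
  rw [a_eq (by omega)]
  nlinarith [ratio_bounds.1]

/-- Keeps `(a - 1)_2` nonzero and excludes the borderline between the two decay regimes. -/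
theorem a_ne_one {N : ℕ} (hN : 1 ≤ N) : a N ≠ 1 := by
  rcases hN.eq_or_lt with rfl | h
  · exact a_one_lt.ne
  · exact (one_lt_a h).ne'

end RIS

/-! ### The integral of `log (1 + t⁻²) t ^ a` for `0 < a < 1` -/

theorem log_one_add_inv_sq_le {t : ℝ} : log (1 + (t ^ 2)⁻¹) ≤ (t ^ 2)⁻¹ := by
  have h : 0 ≤ (t ^ 2)⁻¹ := by positivity
  linarith [log_le_sub_one_of_pos (show 0 < 1 + (t ^ 2)⁻¹ by positivity)]

/-- From `1 + t⁻² ≤ (1 + t⁻¹)²`. This controls the integrand near `0`, where the bound `t⁻²` is too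
weak. -/
theorem log_one_add_inv_sq_le_two_mul_inv {t : ℝ} (ht : 0 < t) :
    log (1 + (t ^ 2)⁻¹) ≤ 2 * t⁻¹ := by
  have h : 0 < t⁻¹ := by positivity
  have h1 : log (1 + (t ^ 2)⁻¹) ≤ log ((1 + t⁻¹) ^ 2) := by
    refine log_le_log (by positivity) ?_
    rw [← inv_pow]
    nlinarith
  rw [log_pow] at h1
  push_cast at h1
  linarith [log_le_sub_one_of_pos (show 0 < 1 + t⁻¹ by positivity)]

theorem log_one_add_inv_sq_nonneg (t : ℝ) : 0 ≤ log (1 + (t ^ 2)⁻¹) :=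
  log_nonneg (by have : 0 ≤ (t ^ 2)⁻¹ := by positivity
                 linarith)

theorem rpow_mul_inv {t : ℝ} (ht : 0 < t) (a : ℝ) : t ^ a * t⁻¹ = t ^ (a - 1) := by
  rw [rpow_sub_one ht.ne', div_eq_mul_inv]

theorem rpow_mul_inv_sq {t : ℝ} (ht : 0 < t) (a : ℝ) : t ^ a * (t ^ 2)⁻¹ = t ^ (a - 2) := by
  rw [rpow_sub ht, rpow_two, div_eq_mul_inv]

theorem integrableOn_rpow_mul_log_one_add_inv_sq {a : ℝ} (h0 : 0 < a) (h1 : a < 1) :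
    IntegrableOn (fun t : ℝ => log (1 + (t ^ 2)⁻¹) * t ^ a) (Ioi 0) := by
  have hmeas (s : Set ℝ) :
      AEStronglyMeasurable (fun t : ℝ => log (1 + (t ^ 2)⁻¹) * t ^ a) (volume.restrict s) :=
    Measurable.aestronglyMeasurable (by fun_prop)
  rw [← Ioc_union_Ioi_eq_Ioi zero_le_one]
  refine IntegrableOn.union ?_ ?_
  · have hi : IntegrableOn (fun t : ℝ => 2 * t ^ (a - 1)) (Ioc 0 1) :=
      (((intervalIntegrable_iff_integrableOn_Ioc_of_le zero_le_one).1
        (intervalIntegral.intervalIntegrable_rpow' (by linarith))).const_mul 2)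
    refine Integrable.mono' hi (hmeas _) ?_
    refine (ae_restrict_iff' measurableSet_Ioc).2 (ae_of_all _ fun t ht => ?_)
    rw [norm_of_nonneg (mul_nonneg (log_one_add_inv_sq_nonneg t) (rpow_nonneg ht.1.le _)),
      ← rpow_mul_inv ht.1]
    nlinarith [log_one_add_inv_sq_le_two_mul_inv ht.1, rpow_pos_of_pos ht.1 a]
  · refine Integrable.mono' (integrableOn_Ioi_rpow_of_lt (a := a - 2) (by linarith) one_pos)
      (hmeas _) ?_
    refine (ae_restrict_iff' measurableSet_Ioi).2 (ae_of_all _ fun t ht => ?_)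
    have ht' : 0 < t := zero_lt_one.trans ht
    rw [norm_of_nonneg (mul_nonneg (log_one_add_inv_sq_nonneg t) (rpow_nonneg ht'.le _)),
      ← rpow_mul_inv_sq ht', mul_comm]
    have := log_one_add_inv_sq_le (t := t)
    gcongr

/-- Write `1 / (1 + t²)` as the integral of `exp (-(1 + t²) s)` over `s > 0` and swap. The
`t`-integral gives one Gamma value, the `s`-integral another, and their arguments sum to `1`, so the
reflection formula applies. -/
theorem integral_rpow_div_one_add_sq {a : ℝ} (h0 : -1 < a) (h1 : a < 1) :
    ∫ t in Ioi (0 : ℝ), t ^ a / (1 + t ^ 2) = π / (2 * cos (a * π / 2)) := by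
  let F : ℝ → ℝ → ℝ := fun s t => exp (-s) * (t ^ a * exp (-s * t ^ (2 : ℝ)))
  have hF0 {s t : ℝ} (ht : 0 < t) : 0 ≤ F s t := by positivity
  have inner {s : ℝ} (hs : 0 < s) : ∫ t in Ioi (0 : ℝ), F s t
      = (1 / 2 * Gamma ((a + 1) / 2)) * (exp (-s) * s ^ ((1 - a) / 2 - 1)) := by
    rw [integral_const_mul, integral_rpow_mul_exp_neg_mul_rpow two_pos h0 hs]
    rw [show -(a + 1) / 2 = (1 - a) / 2 - 1 by ring]
    ring
  have hΓ : IntegrableOn (fun s => exp (-s) * s ^ ((1 - a) / 2 - 1)) (Ioi 0) :=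
    GammaIntegral_convergent (by linarith)
  have hint : Integrable (Function.uncurry F)
      ((volume.restrict (Ioi 0)).prod (volume.restrict (Ioi 0))) := by
    refine (integrable_prod_iff (Measurable.aestronglyMeasurable ?_)).2 ⟨?_, ?_⟩
    · simp only [F, Function.uncurry_def]
      fun_prop
    · refine (ae_restrict_iff' measurableSet_Ioi).2 (ae_of_all _ fun s hs => ?_)
      exact Integrable.const_mul (integrableOn_rpow_mul_exp_neg_mul_rpow h0 two_pos hs) (exp (-s))
    · refine (hΓ.const_mul (1 / 2 * Gamma ((a + 1) / 2))).congr ?_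
      refine (ae_restrict_iff' measurableSet_Ioi).2 (ae_of_all _ fun s hs => ?_)
      change _ = ∫ t in Ioi (0 : ℝ), ‖F s t‖
      refine (inner hs).symm.trans ?_
      exact setIntegral_congr_fun measurableSet_Ioi fun t ht => (norm_of_nonneg (hF0 ht)).symm
  have hswap := integral_integral_swap hint
  have hleft : ∫ s in Ioi (0 : ℝ), ∫ t in Ioi (0 : ℝ), F s t
      = 1 / 2 * Gamma ((a + 1) / 2) * Gamma ((1 - a) / 2) := by
    rw [setIntegral_congr_fun measurableSet_Ioi fun s hs => inner hs, integral_const_mul,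
      Gamma_eq_integral (s := (1 - a) / 2) (by linarith)]
  have hright : ∫ t in Ioi (0 : ℝ), ∫ s in Ioi (0 : ℝ), F s t
      = ∫ t in Ioi (0 : ℝ), t ^ a / (1 + t ^ 2) := by
    refine setIntegral_congr_fun measurableSet_Ioi fun t _ => ?_
    have hc : 0 < 1 + t ^ 2 := by positivity
    have h := integral_rpow_mul_exp_neg_mul_Ioi one_pos hc
    simp only [sub_self, rpow_zero, one_mul, rpow_one, Gamma_one, mul_one] at h
    have hFs (s : ℝ) : F s t = t ^ a * exp (-((1 + t ^ 2) * s)) := by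
      simp only [F, rpow_two]
      rw [mul_left_comm, ← exp_add]
      ring_nf
    simp only [hFs]
    rw [integral_const_mul, h, mul_one_div]
  rw [← hright, ← hswap, hleft, mul_assoc, show (1 - a) / 2 = 1 - (a + 1) / 2 by ring,
    Gamma_mul_Gamma_one_sub, show π * ((a + 1) / 2) = a * π / 2 + π / 2 by ring, sin_add_pi_div_two]
  field_simp

theorem cos_mul_pi_div_two_pos {a : ℝ} (h0 : -1 < a) (h1 : a < 1) : 0 < cos (a * π / 2) :=
  cos_pos_of_mem_Ioo ⟨by nlinarith [pi_pos], by nlinarith [pi_pos]⟩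

/-- Integration by parts turns the logarithm into a multiple of `t ^ a / (1 + t²)`. -/
theorem integral_log_one_add_inv_sq_mul_rpow {a : ℝ} (h0 : 0 < a) (h1 : a < 1) :
    ∫ t in Ioi (0 : ℝ), log (1 + (t ^ 2)⁻¹) * t ^ a = π / ((a + 1) * cos (a * π / 2)) := by
  have hcos := cos_mul_pi_div_two_pos (by linarith) h1
  have hJ := integral_rpow_div_one_add_sq (by linarith) h1
  -- A nonintegrable function has Bochner integral `0`, so the positive value just computed yields
  -- integrability.
  have hJi : IntegrableOn (fun t : ℝ => t ^ a / (1 + t ^ 2)) (Ioi 0) :=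
    .of_integral_ne_zero (by rw [hJ]; positivity)
  have hparts := integral_Ioi_mul_deriv_eq_deriv_mul (a := (0 : ℝ)) (a' := (0 : ℝ)) (b' := (0 : ℝ))
    (u := fun t : ℝ => log (1 + (t ^ 2)⁻¹)) (v := fun t : ℝ => t ^ (a + 1) / (a + 1))
    (u' := fun t => -(2 / (t * (1 + t ^ 2)))) (v' := fun t => t ^ a) ?_ ?_
    (integrableOn_rpow_mul_log_one_add_inv_sq h0 h1) ?_ ?_ ?_
  · rw [hparts, setIntegral_congr_fun (g := fun t => -(2 / (a + 1)) * (t ^ a / (1 + t ^ 2)))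
      measurableSet_Ioi, integral_const_mul, hJ]
    · have : a + 1 ≠ 0 := by linarith
      field_simp
      ring
    · intro t (ht : 0 < t)
      have : a + 1 ≠ 0 := by linarith
      simp only [rpow_add_one ht.ne']
      field_simp
  · intro t (ht : 0 < t)
    have h := (((hasDerivAt_pow 2 t).inv (by positivity)).const_add 1).log
      (show 1 + ((t : ℝ) ^ 2)⁻¹ ≠ 0 by positivity)
    refine h.congr_deriv ?_
    simp only [Pi.inv_apply]
    field_simp
    norm_num
    ring
  · intro t (ht : 0 < t)
    have h := (hasDerivAt_rpow_const (p := a + 1) (Or.inl ht.ne')).div_const (a + 1)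
    refine h.congr_deriv ?_
    have : a + 1 ≠ 0 := by linarith
    rw [add_sub_cancel_right]
    field_simp
  · refine IntegrableOn.congr_fun (hJi.const_mul (-(2 / (a + 1)))) (fun t ht => ?_)
      measurableSet_Ioi
    have ht : 0 < t := ht
    have : a + 1 ≠ 0 := by linarith
    simp only [Pi.mul_apply, rpow_add_one ht.ne']
    field_simp
  -- Boundary term at `0`: the bound `2 t⁻¹` leaves `t ^ a`, which vanishes because `a > 0`.
  · have hlim : Tendsto (fun t : ℝ => 2 * t ^ a / (a + 1)) (𝓝[>] 0) (𝓝 0) := by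
      have := ((continuousAt_rpow_const (0 : ℝ) a (Or.inr h0.le)).tendsto.const_mul 2).div_const
        (a + 1)
      rw [zero_rpow h0.ne', mul_zero, zero_div] at this
      exact this.mono_left nhdsWithin_le_nhds
    refine squeeze_zero' ?_ ?_ hlim
    · filter_upwards [self_mem_nhdsWithin] with t (ht : 0 < t)
      have := log_one_add_inv_sq_nonneg t
      simp only [Pi.mul_apply]
      positivity
    · filter_upwards [self_mem_nhdsWithin] with t (ht : 0 < t)
      have := log_one_add_inv_sq_le_two_mul_inv ht
      have h2 : 2 * t ^ a / (a + 1) = 2 * t⁻¹ * (t ^ (a + 1) / (a + 1)) := by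
        rw [rpow_add_one ht.ne']
        field_simp
      simp only [Pi.mul_apply, h2]
      gcongr
  -- Boundary term at infinity: the bound `t⁻²` leaves `t ^ (a - 1)`, which vanishes because `a <
  -- 1`.
  · have hlim : Tendsto (fun t : ℝ => t ^ (-(1 - a)) / (a + 1)) atTop (𝓝 0) := by
      simpa using (tendsto_rpow_neg_atTop (show 0 < 1 - a by linarith)).div_const (a + 1)
    refine squeeze_zero' ?_ ?_ hlim
    · filter_upwards [eventually_gt_atTop 0] with t ht
      have := log_one_add_inv_sq_nonneg t
      simp only [Pi.mul_apply]
      positivity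
    · filter_upwards [eventually_gt_atTop 0] with t ht
      have := log_one_add_inv_sq_le (t := t)
      have h2 : t ^ (-(1 - a)) / (a + 1) = (t ^ 2)⁻¹ * (t ^ (a + 1) / (a + 1)) := by
        rw [show -(1 - a) = (a + 1) - 2 by ring, ← rpow_mul_inv_sq ht]
        ring
      simp only [Pi.mul_apply, h2]
      gcongr

/-! ### Gamma integrals with logarithmic weights -/

theorem integrableOn_rpow_mul_exp_neg_div {s b : ℝ} (hs : -1 < s) (hb : 0 < b) :
    IntegrableOn (fun y : ℝ => y ^ s * exp (-y / b)) (Ioi 0) := by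
  simpa [rpow_one, div_eq_inv_mul] using
    integrableOn_rpow_mul_exp_neg_mul_rpow hs one_pos (inv_pos.2 hb)

theorem integral_rpow_mul_exp_neg_div {s b : ℝ} (hs : -1 < s) (hb : 0 < b) :
    ∫ y in Ioi (0 : ℝ), y ^ s * exp (-y / b) = b ^ (s + 1) * Gamma (s + 1) := by
  have := integral_rpow_mul_exp_neg_mul_Ioi (show 0 < s + 1 by linarith) (inv_pos.2 hb)
  rw [add_sub_cancel_right, one_div, inv_inv] at this
  simpa [div_eq_inv_mul] using this

theorem integrableOn_log_mul_rpow_mul_exp_neg_div {a b : ℝ} (ha : 0 < a) (hb : 0 < b) :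
    IntegrableOn (fun y : ℝ => log y * (y ^ a * exp (-y / b))) (Ioi 0) := by
  have h1 := integrableOn_rpow_mul_exp_neg_div (show -1 < a + 1 by linarith) hb
  have h2 := integrableOn_rpow_mul_exp_neg_div (show -1 < a - 1 by linarith) hb
  refine Integrable.mono' (h1.add h2) (Measurable.aestronglyMeasurable (by fun_prop)) ?_
  refine (ae_restrict_iff' measurableSet_Ioi).2 (ae_of_all _ fun y (hy : 0 < y) => ?_)
  have hw : 0 < y ^ a * exp (-y / b) := by positivity
  have hlog : |log y| ≤ y + y⁻¹ := by
    have hy' : 0 < y⁻¹ := by positivity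
    have e1 := log_le_sub_one_of_pos hy
    have e2 := log_le_sub_one_of_pos hy'
    rw [log_inv] at e2
    exact abs_le.2 ⟨by linarith, by linarith⟩
  simp only [Pi.add_apply]
  rw [norm_mul, norm_of_nonneg hw.le, Real.norm_eq_abs, rpow_add_one hy.ne', ← rpow_mul_inv hy]
  calc |log y| * (y ^ a * exp (-y / b)) ≤ (y + y⁻¹) * (y ^ a * exp (-y / b)) := by gcongr
    _ = _ := by ring

/-- The left side is the derivative of the complex Gamma integral at `1 + a`, and digamma is `Γ' /
Γ`. -/
theorem integral_log_mul_rpow_mul_exp_neg {a : ℝ} (ha : -1 < a) :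
    ∫ t in Ioi (0 : ℝ), log t * (t ^ a * exp (-t)) = Gamma (a + 1) * digammaReal (1 + a) := by
  have hre : 0 < ((1 + a : ℝ) : ℂ).re := by rw [Complex.ofReal_re]; linarith
  have hd := Complex.hasDerivAt_GammaIntegral hre
  have hev : Complex.Gamma =ᶠ[𝓝 ((1 + a : ℝ) : ℂ)] Complex.GammaIntegral := by
    filter_upwards [(Complex.continuous_re.isOpen_preimage _ isOpen_Ioi).mem_nhds hre] with s hs
    exact Complex.Gamma_eq_integral hs
  have hint : (∫ t : ℝ in Ioi 0, (t : ℂ) ^ (((1 + a : ℝ) : ℂ) - 1) * (log t * exp (-t) : ℂ))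
      = ((∫ t in Ioi (0 : ℝ), log t * (t ^ a * exp (-t)) : ℝ) : ℂ) := by
    rw [← integral_complex_ofReal]
    refine setIntegral_congr_fun measurableSet_Ioi fun t (ht : 0 < t) => ?_
    have : ((1 + a : ℝ) : ℂ) - 1 = (a : ℂ) := by push_cast; ring
    simp only [this, Complex.ofReal_mul, Complex.ofReal_cpow ht.le, Complex.ofReal_exp,
      Complex.ofReal_neg]
    ring
  have hderiv := (hd.congr_of_eventuallyEq hev).deriv
  push_cast at hderiv hint
  rw [digammaReal, Complex.digamma_def, logDeriv_apply, Complex.ofReal_add, Complex.ofReal_one,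
    hderiv, hint, ← Complex.ofReal_one, ← Complex.ofReal_add, Complex.Gamma_ofReal,
    ← Complex.ofReal_div, Complex.ofReal_re, add_comm a 1,
    mul_div_cancel₀ _ (Gamma_pos_of_pos (by linarith)).ne']

theorem integral_log_mul_rpow_mul_exp_neg_div {a b : ℝ} (ha : 0 < a) (hb : 0 < b) :
    ∫ y in Ioi (0 : ℝ), log y * (y ^ a * exp (-y / b))
      = b ^ (a + 1) * Gamma (a + 1) * (log b + digammaReal (1 + a)) := by
  have hsub := integral_comp_mul_left_Ioi (fun y => log y * (y ^ a * exp (-y / b))) 0 hb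
  rw [mul_zero, smul_eq_mul, eq_inv_mul_iff_mul_eq₀ hb.ne'] at hsub
  have i1 := integrableOn_log_mul_rpow_mul_exp_neg_div ha one_pos
  have i2 := integrableOn_rpow_mul_exp_neg_div (show -1 < a by linarith) one_pos
  have e2 := integral_rpow_mul_exp_neg_div (show -1 < a by linarith) one_pos
  simp only [div_one, one_rpow, one_mul] at i1 i2 e2
  have hcongr : ∫ t in Ioi (0 : ℝ), log (b * t) * ((b * t) ^ a * exp (-(b * t) / b))
      = ∫ t in Ioi (0 : ℝ), b ^ a * (log b * (t ^ a * exp (-t)) + log t * (t ^ a * exp (-t))) := by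
    refine setIntegral_congr_fun measurableSet_Ioi fun t (ht : 0 < t) => ?_
    have : -(b * t) / b = -t := by field_simp
    simp only [this, log_mul hb.ne' ht.ne', mul_rpow hb.le ht.le]
    ring
  rw [← hsub, hcongr, integral_const_mul, integral_add (i2.const_mul _) i1, integral_const_mul, e2,
    integral_log_mul_rpow_mul_exp_neg (by linarith), rpow_add_one hb.ne']
  ring

/-! ### Splitting the capacity integral -/

theorem log_one_add_mul_sq_nonneg {ρ : ℝ} (hρ : 0 < ρ) (y : ℝ) : 0 ≤ log (1 + ρ * y ^ 2) :=
  log_nonneg (by have : 0 ≤ ρ * y ^ 2 := by positivity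
                 linarith)

theorem integrableOn_log_one_add_mul_sq_mul {a b ρ : ℝ} (ha : 0 < a) (hb : 0 < b) (hρ : 0 < ρ) :
    IntegrableOn (fun y : ℝ => log (1 + ρ * y ^ 2) * (y ^ a * exp (-y / b))) (Ioi 0) := by
  have h := (integrableOn_rpow_mul_exp_neg_div (show -1 < a + 2 by linarith) hb).const_mul ρ
  refine Integrable.mono' h (Measurable.aestronglyMeasurable (by fun_prop)) ?_
  refine (ae_restrict_iff' measurableSet_Ioi).2 (ae_of_all _ fun y (hy : 0 < y) => ?_)
  have hw : 0 < y ^ a * exp (-y / b) := by positivity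
  have hle : log (1 + ρ * y ^ 2) ≤ ρ * y ^ 2 := by
    linarith [log_le_sub_one_of_pos (show 0 < 1 + ρ * y ^ 2 by positivity)]
  rw [norm_of_nonneg (mul_nonneg (log_one_add_mul_sq_nonneg hρ y) hw.le), rpow_add hy, rpow_two]
  calc log (1 + ρ * y ^ 2) * (y ^ a * exp (-y / b))
      ≤ ρ * y ^ 2 * (y ^ a * exp (-y / b)) := by gcongr
    _ = _ := by ring

theorem log_one_add_mul_sq {ρ y : ℝ} (hρ : 0 < ρ) (hy : 0 < y) :
    log (1 + ρ * y ^ 2) = log ρ + 2 * log y + log (1 + (ρ * y ^ 2)⁻¹) := by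
  have h : 1 + ρ * y ^ 2 = ρ * y ^ 2 * (1 + (ρ * y ^ 2)⁻¹) := by field_simp; ring
  rw [h, log_mul (by positivity) (by positivity), log_mul (by positivity) (by positivity), log_pow]
  push_cast
  ring

theorem integral_log_one_add_mul_sq_mul {a b ρ : ℝ} (ha : 0 < a) (hb : 0 < b) (hρ : 0 < ρ) :
    ∫ y in Ioi (0 : ℝ), log (1 + ρ * y ^ 2) * (y ^ a * exp (-y / b))
      = b ^ (a + 1) * Gamma (a + 1) * (log ρ + 2 * (log b + digammaReal (1 + a)))
        + ∫ y in Ioi (0 : ℝ), log (1 + (ρ * y ^ 2)⁻¹) * (y ^ a * exp (-y / b)) := by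
  have i0 := integrableOn_log_one_add_mul_sq_mul ha hb hρ
  have i1 := (integrableOn_rpow_mul_exp_neg_div (show -1 < a by linarith) hb).const_mul (log ρ)
  have i2 := (integrableOn_log_mul_rpow_mul_exp_neg_div ha hb).const_mul 2
  rw [← sub_eq_iff_eq_add']
  -- Writing the remainder as a difference of integrable functions avoids a separate integrability
  -- proof for it.
  have : ∫ y in Ioi (0 : ℝ), log (1 + (ρ * y ^ 2)⁻¹) * (y ^ a * exp (-y / b))
      = ∫ y in Ioi (0 : ℝ), (log (1 + ρ * y ^ 2) * (y ^ a * exp (-y / b))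
        - (log ρ * (y ^ a * exp (-y / b)) + 2 * (log y * (y ^ a * exp (-y / b))))) := by
    refine setIntegral_congr_fun measurableSet_Ioi fun y (hy : 0 < y) => ?_
    simp only [log_one_add_mul_sq hρ hy]
    ring
  rw [this, integral_sub i0 (Integrable.fun_add i1 i2), integral_add i1 i2, integral_const_mul,
    integral_const_mul, integral_rpow_mul_exp_neg_div (by linarith) hb,
    integral_log_mul_rpow_mul_exp_neg_div ha hb]
  ring

/-! ### Decay of the remainder in the two regimes -/

/-- Pointwise `ρ log (1 + (ρ y²)⁻¹)` is at most `y⁻²` and tends to it; `a > 1` makes the majorant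
integrable at `0`. -/
theorem tendsto_mul_integral_log_one_add_inv {a b : ℝ} (ha : 1 < a) (hb : 0 < b) :
    Tendsto (fun ρ : ℝ => ρ * ∫ y in Ioi (0 : ℝ),
      log (1 + (ρ * y ^ 2)⁻¹) * (y ^ a * exp (-y / b))) atTop
      (𝓝 (b ^ (a - 1) * Gamma (a - 1))) := by
  have hlim := integral_rpow_mul_exp_neg_div (show -1 < a - 2 by linarith) hb
  rw [show a - 2 + 1 = a - 1 by ring] at hlim
  rw [← hlim]
  simp only [← integral_const_mul]
  refine tendsto_integral_filter_of_dominated_convergence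
    (fun y : ℝ => y ^ (a - 2) * exp (-y / b)) (Eventually.of_forall fun ρ =>
      Measurable.aestronglyMeasurable (by fun_prop)) ?_
    (integrableOn_rpow_mul_exp_neg_div (by linarith) hb) ?_
  · filter_upwards [eventually_gt_atTop 0] with ρ hρ
    refine (ae_restrict_iff' measurableSet_Ioi).2 (ae_of_all _ fun y (hy : 0 < y) => ?_)
    have hw : 0 < y ^ a * exp (-y / b) := by positivity
    have h0 : 0 < (ρ * y ^ 2)⁻¹ := by positivity
    have h1 : 0 ≤ log (1 + (ρ * y ^ 2)⁻¹) := log_nonneg (by linarith)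
    have h2 := log_le_sub_one_of_pos (show 0 < 1 + (ρ * y ^ 2)⁻¹ by positivity)
    rw [norm_of_nonneg (by positivity), ← rpow_mul_inv_sq hy]
    calc ρ * (log (1 + (ρ * y ^ 2)⁻¹) * (y ^ a * exp (-y / b)))
        ≤ ρ * ((ρ * y ^ 2)⁻¹ * (y ^ a * exp (-y / b))) := by
          gcongr
          linarith
      _ = _ := by field_simp
  · refine (ae_restrict_iff' measurableSet_Ioi).2 (ae_of_all _ fun y (hy : 0 < y) => ?_)
    have h := (tendsto_mul_log_one_add_div_atTop ((y ^ 2)⁻¹)).mul_const (y ^ a * exp (-y / b))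
    rw [← rpow_mul_inv_sq hy, mul_comm (y ^ a) _⁻¹, mul_assoc]
    refine h.congr fun ρ => ?_
    rw [mul_inv, mul_comm ρ⁻¹, div_eq_mul_inv]
    ring

/-- After `t = √ρ y` only the factor `exp (-t / (√ρ b))` depends on `ρ`; it is at most `1` and tends
to `1`. -/
theorem tendsto_rpow_mul_integral_log_one_add_inv {a b : ℝ} (h0 : 0 < a) (h1 : a < 1)
    (hb : 0 < b) :
    Tendsto (fun ρ : ℝ => ρ ^ ((a + 1) / 2) * ∫ y in Ioi (0 : ℝ),
      log (1 + (ρ * y ^ 2)⁻¹) * (y ^ a * exp (-y / b))) atTop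
      (𝓝 (π / ((a + 1) * cos (a * π / 2)))) := by
  rw [← integral_log_one_add_inv_sq_mul_rpow h0 h1]
  have key : Tendsto (fun ρ : ℝ => ∫ t in Ioi (0 : ℝ),
      log (1 + (t ^ 2)⁻¹) * t ^ a * exp (-t / (√ρ * b))) atTop
      (𝓝 (∫ t in Ioi (0 : ℝ), log (1 + (t ^ 2)⁻¹) * t ^ a)) := by
    refine tendsto_integral_filter_of_dominated_convergence
      (fun t : ℝ => log (1 + (t ^ 2)⁻¹) * t ^ a) (Eventually.of_forall fun ρ =>
        Measurable.aestronglyMeasurable (by fun_prop)) ?_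
      (integrableOn_rpow_mul_log_one_add_inv_sq h0 h1) ?_
    · refine Eventually.of_forall fun ρ => ?_
      refine (ae_restrict_iff' measurableSet_Ioi).2 (ae_of_all _ fun t (ht : 0 < t) => ?_)
      have hn : 0 ≤ log (1 + (t ^ 2)⁻¹) * t ^ a :=
        mul_nonneg (log_one_add_inv_sq_nonneg t) (by positivity)
      have he : exp (-t / (√ρ * b)) ≤ 1 := by
        rw [exp_le_one_iff, neg_div]
        exact neg_nonpos.2 (by positivity)
      rw [norm_of_nonneg (by positivity)]
      exact mul_le_of_le_one_right hn he
    · refine ae_of_all _ fun t => ?_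
      have h : Tendsto (fun ρ : ℝ => -t / (√ρ * b)) atTop (𝓝 0) :=
        (tendsto_sqrt_atTop.atTop_mul_const hb).const_div_atTop _
      simpa using ((continuous_exp.tendsto 0).comp h).const_mul (log (1 + (t ^ 2)⁻¹) * t ^ a)
  refine key.congr' ?_
  filter_upwards [eventually_gt_atTop 0] with ρ hρ
  have hσ : 0 < √ρ := sqrt_pos.2 hρ
  have hsub := integral_comp_mul_left_Ioi
    (fun t : ℝ => log (1 + (t ^ 2)⁻¹) * t ^ a * exp (-t / (√ρ * b))) 0 hσ
  rw [mul_zero, smul_eq_mul, eq_inv_mul_iff_mul_eq₀ hσ.ne'] at hsub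
  -- One factor `√ρ` is the Jacobian; `√ρ ^ a` rescales `y ^ a`.
  rw [← hsub, show ρ ^ ((a + 1) / 2) = √ρ * √ρ ^ a by
    rw [← rpow_one_add' hσ.le (by linarith), sqrt_eq_rpow, ← rpow_mul hρ.le]
    ring_nf, mul_assoc, ← integral_const_mul (√ρ ^ a)]
  congr 1
  refine setIntegral_congr_fun measurableSet_Ioi fun y (hy : 0 < y) => ?_
  have : -(√ρ * y) / (√ρ * b) = -y / b := by field_simp
  simp only [this, mul_pow, sq_sqrt hρ.le, mul_rpow hσ.le hy.le]
  ring

/-! ### Asymptotic comparison of powers -/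

theorem isLittleO_of_tendsto_rpow_mul {f g : ℝ → ℝ} {p l : ℝ}
    (h : Tendsto (fun ρ => ρ ^ p * f ρ) atTop (𝓝 l)) (hg : (fun ρ : ℝ => ρ ^ (-p)) =O[atTop] g) :
    (fun ρ => f ρ - l * ρ ^ (-p)) =o[atTop] g := by
  have h' : (fun ρ => ρ ^ p * f ρ - l) =o[atTop] fun _ => (1 : ℝ) :=
    (isLittleO_one_iff ℝ).2 (by simpa using h.sub_const l)
  refine (h'.mul_isBigO hg).congr' ?_ (by simp)
  filter_upwards [eventually_gt_atTop 0] with ρ hρ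
  rw [sub_mul, mul_right_comm, ← rpow_add hρ]
  simp

theorem isLittleO_sub_one_mul {u e g : ℝ → ℝ} (hu : Tendsto u atTop (𝓝 1)) (he : e =O[atTop] g)
    (k : ℝ) : (fun ρ => k * (u ρ - 1) * e ρ) =o[atTop] g := by
  have h : (fun ρ => k * (u ρ - 1)) =o[atTop] fun _ => (1 : ℝ) :=
    (isLittleO_one_iff ℝ).2 (by simpa using (hu.sub_const 1).const_mul k)
  simpa using h.mul_isBigO he

theorem isLittleO_rpow_neg_rpow_neg {p q : ℝ} (h : q < p) :
    (fun ρ : ℝ => ρ ^ (-p)) =o[atTop] fun ρ => ρ ^ (-q) := by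
  refine (isLittleO_iff_tendsto' ?_).2 ((tendsto_rpow_neg_atTop (sub_pos.2 h)).congr' ?_)
  · filter_upwards [eventually_gt_atTop 0] with ρ hρ h0
    exact absurd h0 (by positivity)
  · filter_upwards [eventually_gt_atTop 0] with ρ hρ
    rw [← rpow_sub hρ]
    ring_nf

theorem isEquivalent_of_sub_isBigO_one {f g : ℝ → ℝ} (hg : Tendsto g atTop atTop)
    (h : (fun x => f x - g x) =O[atTop] fun _ => (1 : ℝ)) : f ~[atTop] g :=
  h.trans_isLittleO ((isLittleO_one_left_iff ℝ).2 (tendsto_norm_atTop_atTop.comp hg))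

/-! ### High-SNR expansion of the capacity -/

namespace RIS

theorem pdfA_eq (N : ℕ) (y : ℝ) :
    pdfA N y = (b N ^ (a N + 1) * Gamma (a N + 1))⁻¹ * (y ^ a N * exp (-y / b N)) := by
  rw [pdfA, div_eq_inv_mul, mul_assoc]

theorem logb_mul_pdfA (N : ℕ) (ρ y : ℝ) : logb 2 (1 + ρ * y ^ 2) * pdfA N y
    = (log 2 * (b N ^ (a N + 1) * Gamma (a N + 1)))⁻¹
      * (log (1 + ρ * y ^ 2) * (y ^ a N * exp (-y / b N))) := by
  rw [pdfA_eq, logb, mul_inv]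
  ring

theorem integrableOn_logb_mul_pdfA {N : ℕ} (hN : 1 ≤ N) {ρ : ℝ} (hρ : 0 < ρ) :
    IntegrableOn (fun y => logb 2 (1 + ρ * y ^ 2) * pdfA N y) (Ioi 0) := by
  simp only [logb_mul_pdfA]
  exact (integrableOn_log_one_add_mul_sq_mul (a_pos hN) (b_pos hN) hρ).const_mul _

/-- The part of the capacity that vanishes at high SNR. -/
def capacityRemainder (N : ℕ) (ρ : ℝ) : ℝ :=
  (log 2 * (b N ^ (a N + 1) * Gamma (a N + 1)))⁻¹
    * ∫ y in Ioi (0 : ℝ), log (1 + (ρ * y ^ 2)⁻¹) * (y ^ a N * exp (-y / b N))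

theorem ergodicCapacity_eq {N : ℕ} (hN : 1 ≤ N) {ρ : ℝ} (hρ : 0 < ρ) :
    ergodicCapacity N ρ
      = (log ρ + 2 * (log (b N) + digammaReal (1 + a N))) / log 2 + capacityRemainder N ρ := by
  have hb := b_pos hN
  have hΓ : 0 < Gamma (a N + 1) := Gamma_pos_of_pos (by linarith [a_pos hN])
  have hK : b N ^ (a N + 1) * Gamma (a N + 1) ≠ 0 := by positivity
  have hl : log 2 ≠ 0 := (log_pos one_lt_two).ne'
  simp only [ergodicCapacity, logb_mul_pdfA]
  rw [integral_const_mul, integral_log_one_add_mul_sq_mul (a_pos hN) hb hρ, mul_add,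
    capacityRemainder]
  congr 1
  field_simp

/-- Coefficient of `ρ ^ (-(a / 2 + 1))` in the high-SNR expression. -/
def coeffCsc (N : ℕ) : ℝ :=
  π * (sin (a N * π / 2))⁻¹ / (log 2 * (2 + a N) * b N ^ (a N + 2) * Gamma (a N + 1))

/-- Coefficient of `ρ ^ (-((a + 1) / 2))` in the high-SNR expression. -/
def coeffSec (N : ℕ) : ℝ :=
  π * (cos (a N * π / 2))⁻¹ / ((a N + 1) * b N ^ (a N + 1) * log 2 * Gamma (a N + 1))

/-- Coefficient of `ρ⁻¹` in the high-SNR expression. -/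
def coeffInv (N : ℕ) : ℝ := 1 / (log 2 * poch (a N - 1) 2 * b N ^ 2)

theorem poch_a_sub_one_two (N : ℕ) : poch (a N - 1) 2 = (a N - 1) * a N := by
  simp [poch, ascPochhammer_succ_eval]

theorem capacityExpr_eq {N : ℕ} (hN : 1 ≤ N) (c u v w : ℝ) {ρ : ℝ} (hρ : 0 < ρ) :
    capacityExpr c N ρ u v w
      = (log ρ + 2 * (log (b N) + digammaReal (c + a N))) / log 2
        + coeffCsc N * u * ρ ^ (-(a N / 2 + 1)) + coeffSec N * v * ρ ^ (-((a N + 1) / 2))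
        + coeffInv N * w * ρ⁻¹ := by
  have hb := b_pos hN
  have h1 : (a N ^ 2 - a N) / poch (a N - 1) 2 = 1 := by
    rw [poch_a_sub_one_two, div_eq_one_iff_eq
      (mul_ne_zero (sub_ne_zero.2 (a_ne_one hN)) (a_pos hN).ne')]
    ring
  have h2 : 2 * (a N ^ 2 - a N) / (log 2 * poch (a N - 1) 2) = 2 / log 2 := by
    rw [mul_comm (log 2), mul_comm 2, mul_div_mul_comm, h1, one_mul]
  rw [capacityExpr, h1, h2, logb, log_mul (by positivity) hρ.ne', log_pow, coeffCsc, coeffSec,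
    coeffInv, rpow_neg hρ.le, rpow_neg hρ.le]
  push_cast
  simp only [div_eq_mul_inv, mul_inv]
  ring

theorem isBigO_inv_decayScale (N : ℕ) : (fun ρ : ℝ => ρ⁻¹) =O[atTop] decayScale N := by
  refine IsBigO.of_bound 1 ?_
  filter_upwards [eventually_gt_atTop 0] with ρ hρ
  rw [norm_of_nonneg (by positivity), norm_of_nonneg (by unfold decayScale; positivity), one_mul,
    decayScale, add_assoc]
  exact le_add_of_nonneg_right (by positivity)

theorem isBigO_sec_decayScale (N : ℕ) :
    (fun ρ : ℝ => ρ ^ (-((a N + 1) / 2))) =O[atTop] decayScale N := by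
  refine IsBigO.of_bound 1 ?_
  filter_upwards [eventually_gt_atTop 0] with ρ hρ
  rw [norm_of_nonneg (by positivity), norm_of_nonneg (by unfold decayScale; positivity), one_mul,
    decayScale, add_right_comm]
  exact le_add_of_nonneg_left (by positivity)

theorem isBigO_csc_decayScale (N : ℕ) :
    (fun ρ : ℝ => ρ ^ (-(a N / 2 + 1))) =O[atTop] decayScale N := by
  refine IsBigO.of_bound 1 ?_
  filter_upwards [eventually_gt_atTop 0] with ρ hρ
  rw [norm_of_nonneg (by positivity), norm_of_nonneg (by unfold decayScale; positivity), one_mul,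
    decayScale]
  exact le_add_of_nonneg_left (by positivity)

theorem tendsto_decayScale {N : ℕ} (hN : 1 ≤ N) : Tendsto (decayScale N) atTop (𝓝 0) := by
  have ha := a_pos hN
  have h := (tendsto_inv_atTop_zero.add
    (tendsto_rpow_neg_atTop (show 0 < (a N + 1) / 2 by linarith))).add
    (tendsto_rpow_neg_atTop (show 0 < a N / 2 + 1 by linarith))
  rwa [add_zero, add_zero] at h

theorem capacityClosedForm_sub_capacityHighSNR {N : ℕ} (hN : 1 ≤ N) (c : ℝ) :
    (fun ρ => capacityClosedForm c N ρ - capacityHighSNR c N ρ) =o[atTop] decayScale N := by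
  have h := ((isLittleO_sub_one_mul (tendsto_factorCsc N) (isBigO_csc_decayScale N)
    (coeffCsc N)).add (isLittleO_sub_one_mul (tendsto_factorSec N) (isBigO_sec_decayScale N)
    (coeffSec N))).add (isLittleO_sub_one_mul (tendsto_factorInv N) (isBigO_inv_decayScale N)
    (coeffInv N))
  refine h.congr' ?_ EventuallyEq.rfl
  filter_upwards [eventually_gt_atTop 0] with ρ hρ
  rw [capacityClosedForm, capacityHighSNR, capacityExpr_eq hN _ _ _ _ hρ,
    capacityExpr_eq hN _ _ _ _ hρ]
  ring

theorem ergodicCapacity_sub_capacityHighSNR_eq {N : ℕ} (hN : 1 ≤ N) {ρ : ℝ} (hρ : 0 < ρ) :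
    ergodicCapacity N ρ - capacityHighSNR 1 N ρ
      = capacityRemainder N ρ - coeffSec N * ρ ^ (-((a N + 1) / 2)) - coeffInv N * ρ⁻¹
        - coeffCsc N * ρ ^ (-(a N / 2 + 1)) := by
  rw [ergodicCapacity_eq hN hρ, capacityHighSNR, capacityExpr_eq hN _ _ _ _ hρ]
  ring

theorem tendsto_capacityRemainder_of_one_lt {N : ℕ} (hN : 1 ≤ N) (ha : 1 < a N) :
    Tendsto (fun ρ => ρ ^ (1 : ℝ) * capacityRemainder N ρ) atTop (𝓝 (coeffInv N)) := by
  have hb := b_pos hN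
  have hl : log 2 ≠ 0 := (log_pos one_lt_two).ne'
  have h := (tendsto_mul_integral_log_one_add_inv ha hb).const_mul
    (log 2 * (b N ^ (a N + 1) * Gamma (a N + 1)))⁻¹
  -- Two steps of the Gamma recursion produce the factor `a (a - 1) = (a - 1)_2` of `coeffInv`.
  have hΓ : Gamma (a N + 1) = a N * ((a N - 1) * Gamma (a N - 1)) := by
    rw [Gamma_add_one (by linarith), ← Gamma_add_one (s := a N - 1) (by linarith), sub_add_cancel]
  have hΓ0 : Gamma (a N - 1) ≠ 0 := (Gamma_pos_of_pos (by linarith)).ne'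
  have hbpow : b N ^ (a N + 1) = b N ^ (a N - 1) * b N ^ 2 := by
    rw [← rpow_two, ← rpow_add hb]
    ring_nf
  have hc : coeffInv N = (log 2 * (b N ^ (a N + 1) * Gamma (a N + 1)))⁻¹
      * (b N ^ (a N - 1) * Gamma (a N - 1)) := by
    have : a N - 1 ≠ 0 := by linarith
    have : a N ≠ 0 := by linarith
    rw [coeffInv, poch_a_sub_one_two, hΓ, hbpow]
    field_simp
  rw [hc]
  refine h.congr fun ρ => ?_
  rw [capacityRemainder, rpow_one]
  ring

theorem tendsto_capacityRemainder_of_lt_one {N : ℕ} (hN : 1 ≤ N) (ha : a N < 1) :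
    Tendsto (fun ρ => ρ ^ ((a N + 1) / 2) * capacityRemainder N ρ) atTop (𝓝 (coeffSec N)) := by
  have h := (tendsto_rpow_mul_integral_log_one_add_inv (a_pos hN) ha (b_pos hN)).const_mul
    (log 2 * (b N ^ (a N + 1) * Gamma (a N + 1)))⁻¹
  have hc : coeffSec N = (log 2 * (b N ^ (a N + 1) * Gamma (a N + 1)))⁻¹
      * (π / ((a N + 1) * cos (a N * π / 2))) := by
    simp only [coeffSec, div_eq_mul_inv, mul_inv]
    ring
  rw [hc]
  refine h.congr fun ρ => ?_
  rw [capacityRemainder]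
  ring

/-- The remainder matches the secant term if `a < 1` and the `ρ⁻¹` term if `a > 1`; the other of
these two is then of lower order. The cosecant term is always `o(ρ⁻¹)`, as `a > 0`. -/
theorem ergodicCapacity_sub_capacityHighSNR {N : ℕ} (hN : 1 ≤ N) :
    (fun ρ => ergodicCapacity N ρ - capacityHighSNR 1 N ρ) =o[atTop] decayScale N := by
  have ha := a_pos hN
  have hinv : (fun ρ : ℝ => ρ ^ (-(1 : ℝ))) =O[atTop] decayScale N := by
    simpa only [rpow_neg_one] using isBigO_inv_decayScale N
  have hcsc : (fun ρ : ℝ => coeffCsc N * ρ ^ (-(a N / 2 + 1))) =o[atTop] decayScale N :=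
    ((isLittleO_rpow_neg_rpow_neg (by linarith)).trans_isBigO hinv).const_mul_left _
  suffices h : (fun ρ => capacityRemainder N ρ - coeffSec N * ρ ^ (-((a N + 1) / 2))
      - coeffInv N * ρ ^ (-(1 : ℝ))) =o[atTop] decayScale N by
    refine (h.sub hcsc).congr' ?_ EventuallyEq.rfl
    filter_upwards [eventually_gt_atTop 0] with ρ hρ
    rw [ergodicCapacity_sub_capacityHighSNR_eq hN hρ, rpow_neg_one]
  rcases (a_ne_one hN).lt_or_gt with h | h
  · exact (isLittleO_of_tendsto_rpow_mul (tendsto_capacityRemainder_of_lt_one hN h)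
      (isBigO_sec_decayScale N)).sub
      (((isLittleO_rpow_neg_rpow_neg (by linarith)).trans_isBigO
        (isBigO_sec_decayScale N)).const_mul_left _)
  · have h1 := isLittleO_of_tendsto_rpow_mul (tendsto_capacityRemainder_of_one_lt hN h) hinv
    have h2 := ((isLittleO_rpow_neg_rpow_neg (show 1 < (a N + 1) / 2 by linarith)).trans_isBigO
      hinv).const_mul_left (coeffSec N)
    refine (h1.sub h2).congr_left fun ρ => ?_
    ring

theorem tendsto_logb_atTop : Tendsto (logb 2) atTop atTop :=
  Real.tendsto_logb_atTop one_lt_two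

/-- The digamma value enters only the bounded part, so any `c` is allowed. -/
theorem capacityHighSNR_isEquivalent {N : ℕ} (hN : 1 ≤ N) (c : ℝ) :
    capacityHighSNR c N ~[atTop] logb 2 := by
  refine isEquivalent_of_sub_isBigO_one tendsto_logb_atTop ?_
  have h : Tendsto (fun ρ => 2 * (log (b N) + digammaReal (c + a N)) / log 2
      + coeffCsc N * ρ ^ (-(a N / 2 + 1)) + coeffSec N * ρ ^ (-((a N + 1) / 2))
      + coeffInv N * ρ⁻¹) atTop (𝓝 _) :=
    ((tendsto_const_nhds.add ((tendsto_rpow_neg_atTop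
      (show 0 < a N / 2 + 1 by linarith [a_pos hN])).const_mul _)).add
      ((tendsto_rpow_neg_atTop (show 0 < (a N + 1) / 2 by linarith [a_pos hN])).const_mul _)).add
      (tendsto_inv_atTop_zero.const_mul _)
  refine (h.isBigO_one ℝ).congr' ?_ EventuallyEq.rfl
  filter_upwards [eventually_gt_atTop 0] with ρ hρ
  rw [capacityHighSNR, capacityExpr_eq hN _ _ _ _ hρ, logb]
  ring

theorem ergodicCapacity_isEquivalent {N : ℕ} (hN : 1 ≤ N) (c : ℝ) :
    ergodicCapacity N ~[atTop] capacityHighSNR c N := by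
  have h1 : ergodicCapacity N ~[atTop] capacityHighSNR 1 N := by
    have hs : decayScale N =O[atTop] fun _ => (1 : ℝ) := (tendsto_decayScale hN).isBigO_one ℝ
    have ho : (fun _ => (1 : ℝ)) =o[atTop] logb 2 :=
      (isLittleO_one_left_iff ℝ).2 (tendsto_norm_atTop_atTop.comp tendsto_logb_atTop)
    exact ((ergodicCapacity_sub_capacityHighSNR hN).trans_isBigO hs).trans_isBigO
      (ho.isBigO.trans (capacityHighSNR_isEquivalent hN 1).isBigO_symm)
  exact h1.trans ((capacityHighSNR_isEquivalent hN 1).trans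
    (capacityHighSNR_isEquivalent hN c).symm)

end RIS

/-! ### Logarithmic growth of the mean for a random gain -/

theorem tendsto_log_one_add_mul_div_log {A : ℝ} (hA : 0 < A) :
    Tendsto (fun ρ => log (1 + ρ * A ^ 2) / log ρ) atTop (𝓝 1) := by
  have h1 : Tendsto (fun ρ : ℝ => log (A ^ 2 + ρ⁻¹)) atTop (𝓝 (log (A ^ 2))) := by
    refine (continuousAt_log (by positivity)).tendsto.comp ?_
    simpa using tendsto_inv_atTop_zero.const_add (A ^ 2)
  have h2 := (h1.div_atTop tendsto_log_atTop).const_add 1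
  rw [add_zero] at h2
  refine h2.congr' ?_
  filter_upwards [eventually_gt_atTop 1] with ρ hρ
  have hρ0 : 0 < ρ := by linarith
  have hl : log ρ ≠ 0 := (log_pos hρ).ne'
  have e : 1 + ρ * A ^ 2 = ρ * (A ^ 2 + ρ⁻¹) := by field_simp; ring
  rw [e, log_mul hρ0.ne' (by positivity), add_div, div_self hl]

theorem log_one_add_sq_le {x : ℝ} (hx : 0 ≤ x) : log (1 + x ^ 2) ≤ 2 * x := by
  have h1 : log (1 + x ^ 2) ≤ log ((1 + x) ^ 2) := log_le_log (by positivity) (by nlinarith)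
  rw [log_pow] at h1
  push_cast at h1
  linarith [log_le_sub_one_of_pos (show 0 < 1 + x by positivity)]

section Moments

variable {Ω : Type*} [MeasurableSpace Ω] {P : Measure Ω} {A : Ω → ℝ}

theorem integrable_log_one_add_mul_sq (hA : Integrable A P) (h0 : ∀ ω, 0 ≤ A ω) {ρ : ℝ}
    (hρ : 0 < ρ) : Integrable (fun ω => log (1 + ρ * A ω ^ 2)) P := by
  have hm := hA.aemeasurable
  refine Integrable.mono' ((hA.const_mul √ρ).const_mul 2)
    (AEMeasurable.aestronglyMeasurable (by fun_prop)) (ae_of_all _ fun ω => ?_)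
  have h := log_one_add_sq_le (mul_nonneg (sqrt_nonneg ρ) (h0 ω))
  rw [mul_pow, sq_sqrt hρ.le] at h
  have hn : 0 ≤ log (1 + ρ * A ω ^ 2) :=
    log_nonneg (by have : 0 ≤ ρ * A ω ^ 2 := by positivity
                   linarith)
  rwa [norm_of_nonneg hn]

/-- The mean of `log₂ (1 + ρ A²)` grows like `log₂ ρ` as soon as `A` is a.s. positive and has a
finite mean. -/
theorem integral_logb_one_add_mul_sq_isEquivalent [IsProbabilityMeasure P] (hA : Integrable A P) (h0 : ∀ ω, 0 ≤ A ω)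
    (hpos : ∀ᵐ ω ∂P, 0 < A ω) :
    (fun ρ : ℝ => ∫ ω, logb 2 (1 + ρ * A ω ^ 2) ∂P) ~[atTop] logb 2 := by
  have hm := hA.aemeasurable
  have key : Tendsto (fun ρ : ℝ => ∫ ω, log (1 + ρ * A ω ^ 2) / log ρ ∂P) atTop
      (𝓝 (∫ _, (1 : ℝ) ∂P)) := by
    refine tendsto_integral_filter_of_dominated_convergence (fun ω => 1 + 2 * A ω)
      (Eventually.of_forall fun ρ => AEMeasurable.aestronglyMeasurable (by fun_prop)) ?_
      ((integrable_const 1).add (hA.const_mul 2))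
      (hpos.mono fun ω h => tendsto_log_one_add_mul_div_log h)
    -- For `ρ ≥ e` one has `log ρ ≥ 1`, whence `(log ρ + 2 A) / log ρ ≤ 1 + 2 A`.
    filter_upwards [eventually_ge_atTop (exp 1)] with ρ hρ
    refine ae_of_all _ fun ω => ?_
    have hρ1 : 1 ≤ ρ := by linarith [add_one_le_exp (1 : ℝ)]
    have hρ0 : 0 < ρ := by linarith
    have hl : 1 ≤ log ρ := (le_log_iff_exp_le hρ0).2 hρ
    have hA2 : 0 ≤ ρ * A ω ^ 2 := by positivity
    have h1 : log (1 + ρ * A ω ^ 2) ≤ log ρ + log (1 + A ω ^ 2) := by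
      rw [← log_mul hρ0.ne' (by positivity)]
      exact log_le_log (by positivity) (by nlinarith)
    have h2 := log_one_add_sq_le (h0 ω)
    have h3 := h0 ω
    rw [norm_of_nonneg (div_nonneg (log_nonneg (by linarith)) (by linarith)),
      div_le_iff₀ (by linarith)]
    nlinarith
  refine isEquivalent_of_tendsto_one ?_
  simp only [integral_const, probReal_univ, smul_eq_mul, mul_one] at key
  refine key.congr fun ρ => ?_
  have hl : log 2 ≠ 0 := (log_pos one_lt_two).ne'
  simp only [logb, Pi.div_apply]
  rw [integral_div, integral_div, div_div_div_cancel_right₀ hl]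

end Moments

/-! ### Rayleigh envelopes -/

namespace RIS

theorem ae_rayleighMeasure_ne_zero (σ : ℝ) : ∀ᵐ x ∂(rayleighMeasure σ), x ≠ 0 :=
  (withDensity_absolutelyContinuous _ _).ae_le (Measure.ae_ne volume 0)

theorem integrable_sq_rayleighMeasure : Integrable (fun x => x ^ 2) (rayleighMeasure 1) := by
  have hm : Measurable fun x : ℝ => if 0 ≤ x then x / 1 ^ 2 * exp (-x ^ 2 / (2 * 1 ^ 2)) else 0 :=
    Measurable.ite measurableSet_Ici (by fun_prop) measurable_const
  rw [rayleighMeasure, integrable_withDensity_iff hm.ennreal_ofReal (by simp)]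
  -- `x²` times the density is `x³ exp (-x² / 2)` on `x ≥ 0`, hence `s = 3` and `b = 1 / 2`.
  refine Integrable.mono' (integrable_rpow_mul_exp_neg_mul_sq (b := 1 / 2) (s := 3) (by norm_num)
    (by norm_num)).norm (Measurable.aestronglyMeasurable (by fun_prop)) (ae_of_all _ fun x => ?_)
  split_ifs with hx
  · rw [ENNReal.toReal_ofReal (by positivity)]
    refine le_of_eq ?_
    rw [show (3 : ℝ) = (3 : ℕ) by norm_num, rpow_natCast]
    congr 1
    ring_nf
  · simp only [ENNReal.ofReal_zero, ENNReal.toReal_zero, mul_zero, norm_zero]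
    exact norm_nonneg _

variable {Ω : Type*} [MeasurableSpace Ω] {P : Measure Ω}

theorem integrable_sq_of_hasLaw {X : Ω → ℝ} (hX : HasLaw X (rayleighMeasure 1) P) :
    Integrable (fun ω => X ω ^ 2) P := by
  have h := integrable_sq_rayleighMeasure
  rw [← hX.map_eq] at h
  exact h.comp_aemeasurable hX.aemeasurable

theorem ae_ne_zero_of_hasLaw {X : Ω → ℝ} (hX : HasLaw X (rayleighMeasure 1) P) :
    ∀ᵐ ω ∂P, X ω ≠ 0 := by
  have h := ae_rayleighMeasure_ne_zero 1
  rw [← hX.map_eq] at h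
  exact ae_of_ae_map hX.aemeasurable h

variable {N : ℕ} {h g : Fin N → Ω → ℂ}

theorem gain_nonneg {Ω : Type*} (h g : Fin N → Ω → ℂ) (ω : Ω) : 0 ≤ gain h g ω :=
  Finset.sum_nonneg fun _ _ => by positivity

/-- Each product is at most the sum of the squares of its factors, so second moments suffice. -/
theorem integrable_gain (hh : ∀ i, HasLaw (fun ω => ‖h i ω‖) (rayleighMeasure 1) P)
    (hg : ∀ i, HasLaw (fun ω => ‖g i ω‖) (rayleighMeasure 1) P) : Integrable (gain h g) P := by
  refine integrable_finsetSum _ fun i _ => ?_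
  refine Integrable.mono' ((integrable_sq_of_hasLaw (hh i)).add (integrable_sq_of_hasLaw (hg i)))
    ((hh i).aemeasurable.mul (hg i).aemeasurable).aestronglyMeasurable (ae_of_all _ fun ω => ?_)
  rw [norm_of_nonneg (by positivity)]
  simp only [Pi.add_apply]
  nlinarith [sq_nonneg (‖h i ω‖ - ‖g i ω‖), sq_nonneg (‖h i ω‖ + ‖g i ω‖)]

theorem ae_gain_pos (hN : 1 ≤ N) (hh : ∀ i, HasLaw (fun ω => ‖h i ω‖) (rayleighMeasure 1) P)
    (hg : ∀ i, HasLaw (fun ω => ‖g i ω‖) (rayleighMeasure 1) P) : ∀ᵐ ω ∂P, 0 < gain h g ω := by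
  filter_upwards [ae_all_iff.2 fun i => ae_ne_zero_of_hasLaw (hh i),
    ae_all_iff.2 fun i => ae_ne_zero_of_hasLaw (hg i)] with ω h1 h2
  refine Finset.sum_pos (fun i _ => ?_) ⟨⟨0, hN⟩, Finset.mem_univ _⟩
  have := h1 i
  have := h2 i
  positivity

end RIS

end

theorem corollary1 (N : ℕ) (hN : 1 ≤ N) :
    -- the three hypergeometric series converge everywhere
    (∀ x : ℝ,
      Summable (hypergeometricTerm [1 + RIS.a N / 2] [3 / 2, 2 + RIS.a N / 2] x) ∧
      Summable (hypergeometricTerm [(RIS.a N + 1) / 2] [1 / 2, (RIS.a N + 3) / 2] x) ∧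
      Summable (hypergeometricTerm [1, 1] [2, 1 - RIS.a N / 2, (3 - RIS.a N) / 2] x)) ∧
    -- the three hypergeometric factors tend to one
    (Tendsto (RIS.factorCsc N) atTop (𝓝 1) ∧
      Tendsto (RIS.factorSec N) atTop (𝓝 1) ∧
      Tendsto (RIS.factorInv N) atTop (𝓝 1)) ∧
    -- the capacity is a convergent integral
    (∀ ρ : ℝ, 0 < ρ →
      IntegrableOn (fun y => logb 2 (1 + ρ * y ^ 2) * RIS.pdfA N y) (Ioi 0)) ∧
    -- the approximation error, relative to the decaying terms that are kept
    ((fun ρ => RIS.ergodicCapacity N ρ - RIS.capacityHighSNR 1 N ρ)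
      =o[atTop] RIS.decayScale N) ∧
    (∀ c ∈ ({1, 3} : Set ℝ),
      -- replacing the hypergeometric factors by one in the closed form
      ((fun ρ => RIS.capacityClosedForm c N ρ - RIS.capacityHighSNR c N ρ)
        =o[atTop] RIS.decayScale N) ∧
      -- asymptotic equivalence with the capacity
      RIS.ergodicCapacity N ~[atTop] RIS.capacityHighSNR c N ∧
      -- asymptotic equivalence with the capacity of the exact Rayleigh channel model
      (∀ (Ω : Type*) [MeasurableSpace Ω] (P : Measure Ω) [IsProbabilityMeasure P]
        (h g : Fin N → Ω → ℂ),
        (∀ i, AEMeasurable (h i) P) → (∀ i, AEMeasurable (g i) P) →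
        (∀ i, HasLaw (fun ω => ‖h i ω‖) (RIS.rayleighMeasure 1) P) →
        (∀ i, HasLaw (fun ω => ‖g i ω‖) (RIS.rayleighMeasure 1) P) →
        iIndepFun (Sum.elim h g) P →
        (∀ ρ : ℝ, 0 < ρ →
          Integrable (fun ω => logb 2 (1 + ρ * RIS.gain h g ω ^ 2)) P) ∧
        (fun ρ : ℝ => ∫ ω, logb 2 (1 + ρ * RIS.gain h g ω ^ 2) ∂P)
          ~[atTop] RIS.capacityHighSNR c N)) := by
  refine ⟨fun x => ⟨summable_hypergeometricTerm_one_two _ _ _ _,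
    summable_hypergeometricTerm_one_two _ _ _ _,
    summable_hypergeometricTerm_two_three _ _ _ _ _ _⟩,
    ⟨RIS.tendsto_factorCsc N, RIS.tendsto_factorSec N, RIS.tendsto_factorInv N⟩,
    fun ρ hρ => RIS.integrableOn_logb_mul_pdfA hN hρ,
    RIS.ergodicCapacity_sub_capacityHighSNR hN, fun c _ =>
    ⟨RIS.capacityClosedForm_sub_capacityHighSNR hN c, RIS.ergodicCapacity_isEquivalent hN c, ?_⟩⟩
  intro Ω _ P _ h g _ _ hh hg _
  have hA := RIS.integrable_gain hh hg
  have h0 := RIS.gain_nonneg h g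
  refine ⟨fun ρ hρ => (integrable_log_one_add_mul_sq hA h0 hρ).div_const _, ?_⟩
  exact (integral_logb_one_add_mul_sq_isEquivalent hA h0 (RIS.ae_gain_pos hN hh hg)).trans
    (RIS.capacityHighSNR_isEquivalent hN c).symm
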